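/- For a polynomial $g\in\mathbb{Z}[x]$ of degree $4$ and a nonzero integer $d$, consider the genus one curve $d y^2=g(x)$ (including its points at infinity, i.e. the curve $d y^2=z^4g(x/z)$ in the weighted projective plane with $x,y,z$ of weights $1,2,1$). It is called everywhere locally solvable (ELS) if it has a point over $\mathbb{R}$ and over $\mathbb{Q}_\ell$ for every prime $\ell$. Let $$H_1^d:\ d y^2=4x^4-56x^2+169,\qquad H_2^d:\ d y^2=18x^4-24x^3-32x^2+40x+34,$$ $$F_1^d:\ d y^2=11x^4+12x^3+56x^2+24x+68,\qquad F_2^d:\ d y^2=x^4+56x^2+676.$$ Let $p$ be a prime and $d=\pm p$. Then: a) $H_1^d$ is ELS if and only if $d\equiv 1\pmod{12}$ or $d=-3$. b) $H_2^d$ is ELS if and only if either $d>0$ and $d\equiv 1\pmod 8$, or $d=2$. c) $F_1^d$ is ELS if and only if $d>0$ and $d\equiv 1$ or $3\pmod 8$. d) $F_2^d$ is ELS if and only if $d>0$ and $d\equiv 1\pmod{12}$. -/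

import Mathlib

/-- A quartic `a x⁴ + b x³ + c x² + e x + f` with integer coefficients. -/
structure IntQuartic where
  a : ℤ
  b : ℤ
  c : ℤ
  e : ℤ
  f : ℤ

namespace IntQuartic

/-- The binary quartic form `a x⁴ + b x³ z + c x² z² + e x z³ + f z⁴` (the homogenization
of the quartic), evaluated in a field `K`. -/
def form (Q : IntQuartic) {K : Type*} [Field K] (x z : K) : K :=
  Q.a * x ^ 4 + Q.b * x ^ 3 * z + Q.c * x ^ 2 * z ^ 2 + Q.e * x * z ^ 3 + Q.f * z ^ 4

/-- The quadratic twist `d y² = Q(x)` has a `K`-rational point. As a genus one curve, the quartic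
is the projective model `d y² = Q(x, z)` in the weighted projective plane with `x, y, z` of
weights `1, 2, 1`, so a point is represented by `(x, y, z)` with `(x, z) ≠ (0, 0)`; the points with
`z ≠ 0` are those of the affine curve, and the points with `z = 0` are the points at infinity. -/
def TwistHasPoint (Q : IntQuartic) (d : ℤ) (K : Type*) [Field K] : Prop :=
  ∃ x y z : K, (x ≠ 0 ∨ z ≠ 0) ∧ (d : K) * y ^ 2 = Q.form x z

/-- The quadratic twist `d y² = Q(x)` is everywhere locally solvable: it has a point over every
completion of `ℚ`, that is, over `ℝ` and over `ℚ_ℓ` for every prime `ℓ`. -/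
def TwistELS (Q : IntQuartic) (d : ℤ) : Prop :=
  Q.TwistHasPoint d ℝ ∧ ∀ (l : ℕ) [Fact l.Prime], Q.TwistHasPoint d ℚ_[l]

end IntQuartic

/-- `4 x⁴ - 56 x² + 169` -/
def quarticH1 : IntQuartic := ⟨4, 0, -56, 0, 169⟩

/-- `18 x⁴ - 24 x³ - 32 x² + 40 x + 34` -/
def quarticH2 : IntQuartic := ⟨18, -24, -32, 40, 34⟩

/-- `11 x⁴ + 12 x³ + 56 x² + 24 x + 68` -/
def quarticF1 : IntQuartic := ⟨11, 12, 56, 24, 68⟩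

/-- `x⁴ + 56 x² + 676` -/
def quarticF2 : IntQuartic := ⟨1, 0, 56, 0, 676⟩

/-!
Obstructions. Up to a constant `w`, each of the quartics is a norm form `A² - c B²` for some
`c ∈ {-2, -1, 2, 3}`. If `c` is not a square modulo `p`, norms from `ℚ_p(√c)` have even valuation,
whereas `w d y²` has odd valuation when `p` exactly divides `d` and `p ∤ w`; so a point over `ℚ_p`
makes `c` a square modulo `p`. If `c < 0`, a real point makes `d` positive. Congruences modulo `16`
and `8` give the remaining conditions at `2`.

Solvability. At a prime `l ≥ 7` of good reduction the reduced curve has a point over `𝔽_l` by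
Stepanov's method: if `d G(x)` were never a square, then `G ^ ((l - 1) / 2)` would be constant on
`𝔽_l`. Hensel's lemma lifts this point. The quartic acquires a root in `ℚ_p` from the square roots
provided by the congruence on `d`, and explicit points serve at `2`, `3` and `∞`.
-/

section FiniteField

open Polynomial

/-- The auxiliary polynomial in Stepanov's method: the derivative of `√G * h`, multiplied by
`2 * √G` to clear the root. -/
noncomputable def stepanovPoly {R : Type*} [CommRing R] (G h : R[X]) : R[X] :=
  2 * G * derivative h + derivative G * h

theorem mul_stepanovPoly {R : Type*} [CommRing R] {G W h : R[X]} {e : R}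
    (hW : derivative W = -1)
    (hode : 2 * G * derivative (C e + W * h) = -(derivative G * (C e + W * h))) :
    W * stepanovPoly G h = 2 * G * h - C e * derivative G := by
  simp only [derivative_add, derivative_C, derivative_mul, hW] at hode
  rw [stepanovPoly]
  linear_combination hode

theorem mul_two_mul_derivative_stepanovPoly_sub {R : Type*} [CommRing R] {G W h : R[X]} {e : R}
    (hW : derivative W = -1) (hWk : W * stepanovPoly G h = 2 * G * h - C e * derivative G) :
    W * (2 * G * derivative (stepanovPoly G h) - derivative G * stepanovPoly G h) =
      C e * (derivative G ^ 2 - 2 * (G * derivative (derivative G))) +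
        4 * (G * stepanovPoly G h) := by
  have hWk' := congrArg derivative hWk
  simp only [derivative_mul, hW, derivative_sub, derivative_C, derivative_ofNat] at hWk'
  have hk : stepanovPoly G h = 2 * G * derivative h + derivative G * h := rfl
  linear_combination (2 * G) * hWk' - derivative G * hWk - (2 * G) * hk

variable {F : Type*} [Field F] [Fintype F]

theorem X_pow_card_sub_X_dvd {P : F[X]} (hP : ∀ x, P.eval x = 0) :
    X ^ Fintype.card F - X ∣ P := by
  rcases eq_or_ne P 0 with rfl | hP0
  · exact dvd_zero _
  have hsplits : (X ^ Fintype.card F - X : F[X]).Splits := by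
    rw [splits_iff_card_roots, FiniteField.roots_X_pow_card_sub_X,
      FiniteField.X_pow_card_sub_X_natDegree_eq F Fintype.one_lt_card]
    rfl
  refine hsplits.dvd_of_roots_le_roots
    (FiniteField.X_pow_card_sub_X_ne_zero F Fintype.one_lt_card) ?_
  rw [FiniteField.roots_X_pow_card_sub_X, Multiset.le_iff_subset Finset.univ.nodup]
  exact fun x _ => (mem_roots hP0).2 (hP x)

theorem derivative_X_pow_card_sub_X : derivative (X ^ Fintype.card F - X : F[X]) = -1 := by
  simp [derivative_X_pow]

theorem two_mul_derivative_pow_half_card (hF : ringChar F ≠ 2) (G : F[X]) :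
    2 * G * derivative (G ^ (Fintype.card F / 2)) =
      -(derivative G * G ^ (Fintype.card F / 2)) := by
  obtain ⟨n, hn⟩ : ∃ n, Fintype.card F / 2 = n + 1 :=
    Nat.exists_eq_succ_of_ne_zero (Nat.div_pos Fintype.one_lt_card two_pos).ne'
  have hodd : 2 * (n + 1) + 1 = Fintype.card F := by
    have := FiniteField.odd_card_of_char_ne_two hF
    omega
  have hneg : 2 * ((n + 1 : ℕ) : F[X]) = -1 := by
    have h : ((2 * (n + 1) + 1 : ℕ) : F[X]) = 0 := by
      rw [hodd, ← map_natCast C, Nat.cast_card_eq_zero, map_zero]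
    push_cast at h ⊢
    linear_combination h
  rw [hn, derivative_pow, map_natCast, Nat.add_sub_cancel]
  linear_combination (G * G ^ n * derivative G) * hneg

theorem natDegree_le_of_X_pow_card_sub_X_mul {P : F[X]} {n : ℕ}
    (h : ((X ^ Fintype.card F - X) * P).natDegree ≤ Fintype.card F + n) : P.natDegree ≤ n := by
  rcases eq_or_ne P 0 with rfl | hP
  · simp
  rw [natDegree_mul (FiniteField.X_pow_card_sub_X_ne_zero F Fintype.one_lt_card) hP,
    FiniteField.X_pow_card_sub_X_natDegree_eq F Fintype.one_lt_card] at h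
  omega

theorem natDegree_stepanovPoly_le_two (hF : ringChar F ≠ 2) (hq : 3 ≤ Fintype.card F) {G h : F[X]}
    {e : F} (hG : G.natDegree ≤ 4)
    (hh : G ^ (Fintype.card F / 2) - C e = (X ^ Fintype.card F - X) * h)
    (hk : (X ^ Fintype.card F - X) * stepanovPoly G h = 2 * G * h - C e * derivative G) :
    (stepanovPoly G h).natDegree ≤ 2 := by
  have hodd := FiniteField.odd_card_of_char_ne_two hF
  have hh_deg : h.natDegree ≤ Fintype.card F - 2 := by
    refine natDegree_le_of_X_pow_card_sub_X_mul ?_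
    calc ((X ^ Fintype.card F - X) * h).natDegree
        = (G ^ (Fintype.card F / 2) - C e).natDegree := by rw [hh]
      _ ≤ Fintype.card F / 2 * 4 := natDegree_sub_C.trans_le (natDegree_pow_le_of_le _ hG)
      _ = Fintype.card F + (Fintype.card F - 2) := by omega
  refine natDegree_le_of_X_pow_card_sub_X_mul ?_
  rw [hk, mul_assoc]
  refine natDegree_sub_le_of_le (m := Fintype.card F + 2) (n := 3) ?_ ?_ |>.trans (by omega)
  · exact (natDegree_mul_le_of_le (natDegree_ofNat 2).le
      (natDegree_mul_le_of_le hG hh_deg)).trans (by omega)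
  · exact (natDegree_C_mul_le _ _).trans ((natDegree_derivative_le G).trans (by omega))

/-- The contradiction in Stepanov's method. If `X ^ q - X` divided `G ^ (q / 2) - e`, then the
differential equation satisfied by `G ^ (q / 2)` would make `X ^ q - X` divide a polynomial of
degree at most `6` which is congruent to `e * G' ^ 2` modulo `G`. -/
theorem not_X_pow_card_sub_X_dvd_pow_half_card_sub_C (hF : ringChar F ≠ 2)
    (hq : 7 ≤ Fintype.card F) {G : F[X]} (hsep : G.Separable) (hG0 : G.natDegree ≠ 0)
    (hG4 : G.natDegree ≤ 4) {e : F} (he : e ≠ 0) :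
    ¬ X ^ Fintype.card F - X ∣ G ^ (Fintype.card F / 2) - C e := by
  rintro ⟨h, hh⟩
  have hode := two_mul_derivative_pow_half_card hF G
  rw [sub_eq_iff_eq_add'.1 hh] at hode
  have hk := mul_stepanovPoly derivative_X_pow_card_sub_X hode
  have hk_deg := natDegree_stepanovPoly_le_two hF (by omega) hG4 hh hk
  have hdvd := Dvd.intro _ (mul_two_mul_derivative_stepanovPoly_sub derivative_X_pow_card_sub_X hk)
  have hzero := eq_zero_of_dvd_of_natDegree_lt hdvd <| by
    have hG' : (derivative G).natDegree ≤ 3 := (natDegree_derivative_le G).trans (by omega)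
    have hG'' : (derivative (derivative G)).natDegree ≤ 2 :=
      (natDegree_derivative_le _).trans (by omega)
    rw [FiniteField.X_pow_card_sub_X_natDegree_eq F Fintype.one_lt_card]
    refine lt_of_le_of_lt (b := 6) (natDegree_add_le_of_degree_le
      ((natDegree_C_mul_le _ _).trans (natDegree_sub_le_of_le (m := 6) (n := 6) ?_ ?_)) ?_) hq
    · exact natDegree_pow_le_of_le 2 hG'
    · exact natDegree_mul_le_of_le (natDegree_ofNat 2).le (natDegree_mul_le_of_le hG4 hG'')
    · exact natDegree_mul_le_of_le (natDegree_ofNat 4).le (natDegree_mul_le_of_le hG4 hk_deg)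
  have hdvd' : G ∣ C e * derivative G ^ 2 :=
    ⟨2 * C e * derivative (derivative G) - 4 * stepanovPoly G h, by linear_combination hzero⟩
  rw [(isUnit_C.2 he.isUnit).dvd_mul_left] at hdvd'
  exact hG0 (natDegree_eq_zero_of_isUnit ((hsep.pow_right (n := 2)).isUnit_of_dvd' dvd_rfl hdvd'))

theorem pow_half_card_eq_neg_of_not_isSquare_mul (hF : ringChar F ≠ 2) {a c : F} (hc : c ≠ 0)
    (h : ¬ IsSquare (c * a)) : a ^ (Fintype.card F / 2) = -c ^ (Fintype.card F / 2) := by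
  have hca : c * a ≠ 0 := fun h0 => h (h0 ▸ IsSquare.zero)
  rw [FiniteField.isSquare_iff hF hca] at h
  have hca' := (FiniteField.pow_dichotomy hF hca).resolve_left h
  rw [mul_pow] at hca'
  rcases FiniteField.pow_dichotomy hF hc with hc' | hc' <;> rw [hc'] at hca' ⊢
  · linear_combination hca'
  · linear_combination -hca'

theorem exists_mul_sq_eq_eval_of_separable (hq : 7 ≤ Fintype.card F) {G : F[X]}
    (hsep : G.Separable) (hG0 : G.natDegree ≠ 0) (hG4 : G.natDegree ≤ 4) {c : F} (hc : c ≠ 0) :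
    ∃ x y : F, c * y ^ 2 = G.eval x := by
  suffices h : ∃ x, IsSquare (c * G.eval x) by
    obtain ⟨x, r, hr⟩ := h
    exact ⟨x, r / c, by field_simp; linear_combination -hr⟩
  by_cases hF : ringChar F = 2
  · exact ⟨0, FiniteField.isSquare_of_char_two hF _⟩
  by_contra! hns
  refine not_X_pow_card_sub_X_dvd_pow_half_card_sub_C hF hq hsep hG0 hG4
    (neg_ne_zero.2 (pow_ne_zero (Fintype.card F / 2) hc)) (X_pow_card_sub_X_dvd fun x => ?_)
  rw [eval_sub, eval_pow, eval_C, pow_half_card_eq_neg_of_not_isSquare_mul hF hc (hns x), sub_self]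

end FiniteField

section Padic

variable {p : ℕ} [Fact p.Prime]

theorem norm_eq_one_iff_toZMod_ne_zero {x : ℤ_[p]} : ‖x‖ = 1 ↔ PadicInt.toZMod x ≠ 0 := by
  rw [← PadicInt.isUnit_iff, Ne, ← RingHom.mem_ker, PadicInt.ker_toZMod,
    IsLocalRing.notMem_maximalIdeal]

open Polynomial in
theorem exists_padicInt_root_of_zmod_root (P : ℤ[X]) {x : ZMod p} (h0 : aeval x P = 0)
    (h1 : aeval x (derivative P) ≠ 0) : ∃ z : ℤ_[p], aeval z P = 0 := by
  obtain ⟨a, rfl⟩ := ZMod.ringHom_surjective (PadicInt.toZMod (p := p)) x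
  have haeval (R : ℤ[X]) : aeval (PadicInt.toZMod a) R = PadicInt.toZMod (aeval a R) :=
    aeval_algHom_apply PadicInt.toZMod.toIntAlgHom a R
  rw [haeval] at h0 h1
  have hlt : ‖aeval a P‖ < 1 :=
    (PadicInt.norm_le_one _).lt_of_ne fun h => norm_eq_one_iff_toZMod_ne_zero.1 h h0
  obtain ⟨z, hz, -⟩ := hensels_lemma (F := P) (a := a) (by
    rwa [norm_eq_one_iff_toZMod_ne_zero.2 h1, one_pow])
  exact ⟨z, hz⟩

theorem isSquare_intCast_of_padicInt_sq_eq {z : ℤ_[p]} {u : ℤ} (h : z ^ 2 = u) :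
    IsSquare (u : ℚ_[p]) :=
  ⟨z, by rw [← sq, ← PadicInt.coe_pow, h, PadicInt.coe_intCast]⟩

open Polynomial in
theorem aeval_derivative_X_sq_sub_C {R : Type*} [CommRing R] (x : R) (u : ℤ) :
    aeval x (derivative (X ^ 2 - C u)) = 2 * x := by
  rw [derivative_sub, derivative_X_sq, derivative_C, sub_zero, map_mul, aeval_X, map_ofNat,
    map_ofNat]

open Polynomial in
theorem isSquare_padic_of_isSquare_zmod (hp : p ≠ 2) {u : ℤ} (hu : (u : ZMod p) ≠ 0)
    (hs : IsSquare (u : ZMod p)) : IsSquare (u : ℚ_[p]) := by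
  obtain ⟨r, hr⟩ := hs
  have hr0 : r ≠ 0 := fun h => hu (by rw [hr, h, mul_zero])
  have h2 : (2 : ZMod p) ≠ 0 := Ring.two_ne_zero (by rwa [ZMod.ringChar_zmod_n])
  obtain ⟨z, hz⟩ := exists_padicInt_root_of_zmod_root (X ^ 2 - C u) (x := r)
    (by simp [hr, sq]) (by rw [aeval_derivative_X_sq_sub_C]; exact mul_ne_zero h2 hr0)
  exact isSquare_intCast_of_padicInt_sq_eq (z := z) (by simpa [sub_eq_zero] using hz)

open Polynomial in
theorem isSquare_padic_two_of_modEq {u : ℤ} (hu : u ≡ 1 [ZMOD 8]) : IsSquare (u : ℚ_[2]) := by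
  have hval : ‖((1 - u : ℤ) : ℤ_[2])‖ ≤ (2 : ℝ) ^ (-3 : ℤ) := by
    simpa using (PadicInt.norm_int_le_pow_iff_dvd (p := 2) (k := 1 - u) (n := 3)).2 hu.dvd
  have hderiv : ‖(2 : ℤ_[2])‖ = 2⁻¹ := by simpa using PadicInt.norm_p (p := 2)
  obtain ⟨z, hz, -⟩ := hensels_lemma (p := 2) (F := (X ^ 2 - C u : ℤ[X])) (a := 1) (by
    rw [show aeval (1 : ℤ_[2]) (X ^ 2 - C u : ℤ[X]) = ((1 - u : ℤ) : ℤ_[2]) by simp,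
      aeval_derivative_X_sq_sub_C, mul_one, hderiv]
    exact hval.trans_lt (by norm_num))
  exact isSquare_intCast_of_padicInt_sq_eq (z := z) (by simpa [sub_eq_zero] using hz)

theorem isSquare_padic_three_of_modEq {u : ℤ} (hu : u ≡ 1 [ZMOD 3]) : IsSquare (u : ℚ_[3]) := by
  have h : (u : ZMod 3) = 1 := by
    simpa using (ZMod.intCast_eq_intCast_iff u 1 3).2 hu
  exact isSquare_padic_of_isSquare_zmod (by norm_num) (h ▸ one_ne_zero) (h ▸ IsSquare.one)

theorem exists_primitive_padicInt {x z : ℚ_[p]} (h : x ≠ 0 ∨ z ≠ 0) :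
    ∃ m : ℚ_[p], m ≠ 0 ∧ ∃ s t : ℤ_[p], (s = 1 ∨ t = 1) ∧ x = m * s ∧ z = m * t := by
  wlog hxz : ‖x‖ ≤ ‖z‖ generalizing x z
  · obtain ⟨m, hm, s, t, hst, hz, hx⟩ := this h.symm (le_of_not_ge hxz)
    exact ⟨m, hm, t, s, hst.symm, hx, hz⟩
  have hz : z ≠ 0 := by
    rintro rfl
    simp_all
  refine ⟨z, hz, ⟨x / z, ?_⟩, 1, Or.inr rfl, ?_, ?_⟩
  · rw [norm_div]
    exact div_le_one_of_le₀ hxz (norm_nonneg _)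
  · exact (mul_div_cancel₀ x hz).symm
  · simp

theorem isSquare_of_sq_sub_mul_sq_eq_zero {K : Type*} [Field K] {c A B : K} (hAB : A ≠ 0 ∨ B ≠ 0)
    (h : A ^ 2 - c * B ^ 2 = 0) : IsSquare c := by
  have hB : B ≠ 0 := by
    rintro rfl
    simp_all
  exact ⟨A / B, by field_simp; linear_combination -h⟩

theorem valuation_eq_zero_of_norm_eq_one {x : ℚ_[p]} (h : ‖x‖ = 1) : x.valuation = 0 := by
  have h_inv : 0 ≤ (x⁻¹).valuation := (Padic.norm_le_one_iff_val_nonneg _).1 (by simp [h])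
  have := (Padic.norm_le_one_iff_val_nonneg x).1 h.le
  rw [Padic.valuation_inv] at h_inv
  omega

/-- Norms from the unramified quadratic extension of `ℚ_p` have even valuation. -/
theorem even_valuation_sq_sub_mul_sq {c : ℤ} (hc : ¬ IsSquare (c : ZMod p)) {A B : ℚ_[p]}
    (hAB : A ≠ 0 ∨ B ≠ 0) :
    A ^ 2 - c * B ^ 2 ≠ 0 ∧ Even (A ^ 2 - c * B ^ 2).valuation := by
  obtain ⟨m, hm, s, t, hst, rfl, rfl⟩ := exists_primitive_padicInt hAB
  have hst' : PadicInt.toZMod s ≠ 0 ∨ PadicInt.toZMod t ≠ 0 := by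
    rcases hst with rfl | rfl <;> simp
  have hunit : ‖s ^ 2 - c * t ^ 2‖ = 1 := by
    rw [norm_eq_one_iff_toZMod_ne_zero]
    simpa using mt (isSquare_of_sq_sub_mul_sq_eq_zero hst') hc
  have hval : ((s ^ 2 - c * t ^ 2 : ℤ_[p]) : ℚ_[p]).valuation = 0 :=
    valuation_eq_zero_of_norm_eq_one hunit
  have hu0 : ((s ^ 2 - c * t ^ 2 : ℤ_[p]) : ℚ_[p]) ≠ 0 :=
    norm_ne_zero_iff.1 (hunit.trans_ne one_ne_zero)
  have hfactor : (m * s) ^ 2 - c * (m * t) ^ 2 = m ^ 2 * (s ^ 2 - c * t ^ 2 : ℤ_[p]) := by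
    push_cast
    ring
  rw [hfactor]
  refine ⟨mul_ne_zero (pow_ne_zero 2 hm) hu0, ?_⟩
  rw [Padic.valuation_mul (pow_ne_zero 2 hm) hu0, hval, Padic.valuation_pow, add_zero]
  exact even_two_mul _

theorem padicValInt_le_one_of_squarefree {d : ℤ} (hd : Squarefree d) : padicValInt p d ≤ 1 := by
  by_contra! h
  have := (padicValInt_dvd_iff 2 d).2 (Or.inr h)
  exact (Nat.prime_iff_prime_int.1 Fact.out).not_isUnit (hd p (by rwa [← sq]))

theorem padicValInt_eq_one_of_squarefree {d : ℤ} (hd : Squarefree d) (hpd : (p : ℤ) ∣ d) :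
    padicValInt p d = 1 :=
  (padicValInt_le_one_of_squarefree hd).antisymm
    ((padicValInt_dvd_iff 1 d).1 (by rwa [pow_one]) |>.resolve_left hd.ne_zero)

theorem norm_le_one_of_squarefree_mul_sq {d : ℤ} (hd : Squarefree d) {y : ℚ_[p]}
    (h : ‖d * y ^ 2‖ ≤ 1) : ‖y‖ ≤ 1 := by
  rcases eq_or_ne y 0 with rfl | hy
  · simp
  rw [Padic.norm_le_one_iff_val_nonneg, Padic.valuation_mul (mod_cast hd.ne_zero)
    (pow_ne_zero 2 hy), Padic.valuation_intCast, Padic.valuation_pow] at h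
  rw [Padic.norm_le_one_iff_val_nonneg]
  have := padicValInt_le_one_of_squarefree (p := p) hd
  push_cast at h
  omega

end Padic

theorem isSquare_three_zmod_iff {p : ℕ} [Fact p.Prime] (hp2 : p ≠ 2) (hp3 : p ≠ 3) :
    IsSquare (3 : ZMod p) ↔ p % 12 = 1 ∨ p % 12 = 11 := by
  have hp : p.Prime := Fact.out
  have hodd : p % 2 = 1 := hp.eq_two_or_odd.resolve_left hp2
  have hmod3 : p % 3 = 1 ∨ p % 3 = 2 := by
    have := (Nat.prime_dvd_prime_iff_eq Nat.prime_three hp).not.2 hp3.symm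
    omega
  have hsq : IsSquare (p : ZMod 3) ↔ p % 3 = 1 := by
    rw [← ZMod.natCast_mod]
    rcases hmod3 with h | h <;> rw [h] <;> decide
  rcases (by omega : p % 4 = 1 ∨ p % 4 = 3) with h4 | h4
  · rw [← Nat.cast_three, ZMod.exists_sq_eq_prime_iff_of_mod_four_eq_one h4 (by norm_num), hsq]
    omega
  · rw [← Nat.cast_three, ZMod.exists_sq_eq_prime_iff_of_mod_four_eq_three h4 (by norm_num) hp3,
      hsq]
    omega

section PadicSquares

variable {p : ℕ} [Fact p.Prime]

theorem isSquare_neg_one_padic (h : p % 4 = 1) : IsSquare (-1 : ℚ_[p]) := by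
  have := isSquare_padic_of_isSquare_zmod (p := p) (u := -1) (by omega) (by simp)
    (by simpa using ZMod.exists_sq_eq_neg_one_iff.2 (by omega))
  simpa using this

theorem isSquare_two_padic (h : p % 8 = 1 ∨ p % 8 = 7) : IsSquare (2 : ℚ_[p]) := by
  have hp2 : p ≠ 2 := by omega
  have := isSquare_padic_of_isSquare_zmod (p := p) (u := 2) hp2
    (by exact_mod_cast ZMod.prime_ne_zero p 2 hp2)
    (by simpa using (ZMod.exists_sq_eq_two_iff hp2).2 h)
  simpa using this

theorem isSquare_neg_two_padic (h : p % 8 = 1 ∨ p % 8 = 3) : IsSquare (-2 : ℚ_[p]) := by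
  have hp2 : p ≠ 2 := by omega
  have := isSquare_padic_of_isSquare_zmod (p := p) (u := -2) hp2
    (by simpa using ZMod.prime_ne_zero p 2 hp2)
    (by simpa using (ZMod.exists_sq_eq_neg_two_iff hp2).2 h)
  simpa using this

theorem isSquare_three_padic (h : p % 12 = 1 ∨ p % 12 = 11) : IsSquare (3 : ℚ_[p]) := by
  have hp2 : p ≠ 2 := by omega
  have hp3 : p ≠ 3 := by omega
  have := isSquare_padic_of_isSquare_zmod (p := p) (u := 3) hp2
    (by exact_mod_cast ZMod.prime_ne_zero p 3 hp3)
    (by simpa using (isSquare_three_zmod_iff hp2 hp3).2 h)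
  simpa using this

end PadicSquares

namespace IntQuartic

open Polynomial

/-- The binary quartic form `IntQuartic.form`, evaluated in a commutative ring, so that it can be
reduced modulo integers. -/
def eval (Q : IntQuartic) {R : Type*} [CommRing R] (x z : R) : R :=
  Q.a * x ^ 4 + Q.b * x ^ 3 * z + Q.c * x ^ 2 * z ^ 2 + Q.e * x * z ^ 3 + Q.f * z ^ 4

/-- The dehomogenized quartic as a polynomial. -/
noncomputable def poly (Q : IntQuartic) : ℤ[X] :=
  C Q.a * X ^ 4 + C Q.b * X ^ 3 + C Q.c * X ^ 2 + C Q.e * X + C Q.f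

variable {Q : IntQuartic} {d w c : ℤ} {l : ℕ} [Fact l.Prime]

theorem form_eq_eval {K : Type*} [Field K] (x z : K) : Q.form x z = Q.eval x z := rfl

theorem map_eval {R S : Type*} [CommRing R] [CommRing S] (φ : R →+* S) (x z : R) :
    φ (Q.eval x z) = Q.eval (φ x) (φ z) := by
  simp [eval]

theorem intCast_eval {R : Type*} [CommRing R] (x z : ℤ) : (Q.eval x z : ℤ) = Q.eval (x : R) z :=
  map_eval (Int.castRingHom R) x z

theorem eval_mul_mul {R : Type*} [CommRing R] (m x z : R) :
    Q.eval (m * x) (m * z) = m ^ 4 * Q.eval x z := by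
  simp only [eval]
  ring

theorem aeval_poly {R : Type*} [CommRing R] (x : R) : aeval x Q.poly = Q.eval x 1 := by
  simp [poly, eval]

theorem natDegree_poly_le : Q.poly.natDegree ≤ 4 := by
  unfold poly
  compute_degree

theorem twistHasPoint_of_form_eq_zero {K : Type*} [Field K] (x : K) (hx : Q.form x 1 = 0) :
    Q.TwistHasPoint d K :=
  ⟨x, 0, 1, Or.inr one_ne_zero, by simp [hx]⟩

theorem twistHasPoint_of_eval_eq_mul_sq {K : Type*} [Field K] [CharZero K] (hd : d ≠ 0)
    (x z m u : ℤ) (hxz : x ≠ 0 ∨ z ≠ 0) (h : d * Q.eval x z = u * m ^ 2)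
    (hu : IsSquare (u : K)) : Q.TwistHasPoint d K := by
  obtain ⟨r, hr⟩ := hu
  have hd' : (d : K) ≠ 0 := by exact_mod_cast hd
  refine ⟨x, r * m / d, z, by exact_mod_cast hxz, ?_⟩
  have h' := congrArg (Int.cast : ℤ → K) h
  push_cast [intCast_eval] at h'
  rw [form_eq_eval]
  field_simp
  linear_combination -h' - (m : K) ^ 2 * hr

theorem twistHasPoint_real_of_nonneg (hd : d ≠ 0) (x z : ℤ) (hxz : x ≠ 0 ∨ z ≠ 0)
    (h : 0 ≤ d * Q.eval x z) : Q.TwistHasPoint d ℝ :=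
  twistHasPoint_of_eval_eq_mul_sq hd x z 1 (d * Q.eval x z) hxz (by ring)
    (Real.isSquare_iff.2 (by exact_mod_cast h))

theorem twistHasPoint_of_zmod_point (hl : l ≠ 2) (hd : (d : ZMod l) ≠ 0) {x y : ZMod l}
    (hy : y ≠ 0) (h : d * y ^ 2 = Q.eval x 1) : Q.TwistHasPoint d ℚ_[l] := by
  obtain ⟨n, rfl⟩ := ZMod.intCast_surjective x
  have heval : ((d * Q.eval n 1 : ℤ) : ZMod l) = (d * y) ^ 2 := by
    rw [Int.cast_mul, intCast_eval, Int.cast_one, ← h]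
    ring
  refine twistHasPoint_of_eval_eq_mul_sq (by rintro rfl; simp at hd) n 1 1 (d * Q.eval n 1)
    (Or.inr one_ne_zero) (by ring) (isSquare_padic_of_isSquare_zmod hl ?_ ?_)
  · rw [heval]
    exact pow_ne_zero 2 (mul_ne_zero hd hy)
  · rw [heval]
    exact IsSquare.sq _

theorem twistHasPoint_of_zmod_root {x : ZMod l} (h0 : aeval x Q.poly = 0)
    (h1 : aeval x (derivative Q.poly) ≠ 0) : Q.TwistHasPoint d ℚ_[l] := by
  obtain ⟨z, hz⟩ := exists_padicInt_root_of_zmod_root Q.poly h0 h1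
  refine twistHasPoint_of_form_eq_zero (z : ℚ_[l]) ?_
  have := map_eval (Q := Q) PadicInt.Coe.ringHom z 1
  rw [← aeval_poly, hz, map_zero, map_one] at this
  exact this.symm

theorem twistHasPoint_of_separable (hl : 7 ≤ l) (hd : (d : ZMod l) ≠ 0)
    (hsep : (Q.poly.map (Int.castRingHom (ZMod l))).Separable)
    (hdeg : (Q.poly.map (Int.castRingHom (ZMod l))).natDegree ≠ 0) :
    Q.TwistHasPoint d ℚ_[l] := by
  have heval (P : ℤ[X]) (x : ZMod l) : (P.map (Int.castRingHom (ZMod l))).eval x = aeval x P := by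
    rw [eval_map, aeval_def, algebraMap_int_eq]
  obtain ⟨x, y, hxy⟩ := exists_mul_sq_eq_eval_of_separable (by rwa [ZMod.card]) hsep hdeg
    (natDegree_map_le.trans natDegree_poly_le) hd
  rw [heval] at hxy
  by_cases hy : y = 0
  · have hroot : aeval x Q.poly = 0 := by
      rw [← hxy, hy]
      ring
    refine twistHasPoint_of_zmod_root hroot ?_
    rw [← heval, ← derivative_map]
    exact hsep.eval₂_derivative_ne_zero (RingHom.id _) (by rw [← hroot, ← heval]; rfl)
  · exact twistHasPoint_of_zmod_point (by omega) hd hy (by rw [hxy, aeval_poly])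

theorem separable_map_poly {U V : ℤ[X]} {N : ℤ}
    (hUV : U * Q.poly + V * derivative Q.poly = C N) (hN : (N : ZMod l) ≠ 0) :
    (Q.poly.map (Int.castRingHom (ZMod l))).Separable := by
  have h := congrArg (Polynomial.map (Int.castRingHom (ZMod l))) hUV
  rw [Polynomial.map_add, Polynomial.map_mul, Polynomial.map_mul, ← derivative_map, map_C] at h
  have hN' : (C (N : ZMod l)⁻¹ : (ZMod l)[X]) * C (Int.castRingHom (ZMod l) N) = 1 := by
    rw [← C_mul, eq_intCast, inv_mul_cancel₀ hN, C_1]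
  exact ⟨C (N : ZMod l)⁻¹ * U.map _, C (N : ZMod l)⁻¹ * V.map _, by rw [← hN', ← h]; ring⟩

theorem derivative_poly :
    derivative Q.poly = C (4 * Q.a) * X ^ 3 + C (3 * Q.b) * X ^ 2 + C (2 * Q.c) * X + C Q.e := by
  simp only [poly, derivative_add, derivative_C_mul, derivative_X_pow, derivative_X, derivative_C,
    C_mul]
  push_cast
  ring

theorem coeff_poly_three : Q.poly.coeff 3 = Q.b := by
  simp [poly, -eq_intCast]

theorem coeff_poly_four : Q.poly.coeff 4 = Q.a := by
  unfold poly
  compute_degree!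

theorem natDegree_map_poly_ne_zero {R : Type*} [CommRing R]
    (h : (Q.a : R) ≠ 0 ∨ (Q.b : R) ≠ 0) :
    (Q.poly.map (Int.castRingHom R)).natDegree ≠ 0 := by
  have hcoeff (n : ℕ) (hn : n ≠ 0) (h0 : (Q.poly.map (Int.castRingHom R)).natDegree = 0) :
      (Q.poly.coeff n : R) = 0 := by
    rw [← eq_intCast (Int.castRingHom R), ← coeff_map]
    exact coeff_eq_zero_of_natDegree_lt (by omega)
  rw [← coeff_poly_four, ← coeff_poly_three] at h
  exact fun h0 => h.elim (· (hcoeff 4 (by norm_num) h0)) (· (hcoeff 3 (by norm_num) h0))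

theorem twistHasPoint_of_five_le {U V : ℤ[X]} {N : ℤ} {k : ℕ}
    (hUV : U * Q.poly + V * derivative Q.poly = C N) (hN : N ∣ (2 * 3 * 13) ^ k)
    (hlead : Q.a ∣ (2 * 3 * 13) ^ k ∨ Q.b ∣ (2 * 3 * 13) ^ k)
    (h5 : ∀ d : ZMod 5, d ≠ 0 → ∃ x y : ZMod 5, y ≠ 0 ∧ d * y ^ 2 = Q.eval x 1)
    (h13 : ∀ d : ZMod 13, d ≠ 0 → ∃ x y : ZMod 13, y ≠ 0 ∧ d * y ^ 2 = Q.eval x 1)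
    (hl : 5 ≤ l) (hd : (d : ZMod l) ≠ 0) : Q.TwistHasPoint d ℚ_[l] := by
  rcases eq_or_ne l 5 with rfl | hl5
  · obtain ⟨x, y, hy, h⟩ := h5 d hd
    exact twistHasPoint_of_zmod_point (by norm_num) hd hy h
  rcases eq_or_ne l 13 with rfl | hl13
  · obtain ⟨x, y, hy, h⟩ := h13 d hd
    exact twistHasPoint_of_zmod_point (by norm_num) hd hy h
  have hl6 : l ≠ 6 := by
    rintro rfl
    exact absurd (Fact.out : Nat.Prime 6) (by norm_num)
  have hl78 : ¬ l ∣ 2 * 3 * 13 := by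
    have hlp : l.Prime := Fact.out
    rw [hlp.dvd_mul, hlp.dvd_mul, Nat.prime_dvd_prime_iff_eq hlp Nat.prime_two,
      Nat.prime_dvd_prime_iff_eq hlp Nat.prime_three,
      Nat.prime_dvd_prime_iff_eq hlp (by norm_num)]
    omega
  have hunit {n : ℤ} (hn : n ∣ (2 * 3 * 13) ^ k) : (n : ZMod l) ≠ 0 := by
    rw [Ne, ZMod.intCast_zmod_eq_zero_iff_dvd]
    exact fun h => hl78 (by exact_mod_cast
      (Nat.prime_iff_prime_int.1 Fact.out).dvd_of_dvd_pow (h.trans hn))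
  exact twistHasPoint_of_separable (by omega) hd (separable_map_poly hUV (hunit hN))
    (natDegree_map_poly_ne_zero (hlead.imp hunit hunit))

theorem TwistHasPoint.exists_primitive_zmod (h : Q.TwistHasPoint d ℚ_[l]) (hd : Squarefree d)
    (n : ℕ) : ∃ s t y : ZMod (l ^ n), (s = 1 ∨ t = 1) ∧ d * y ^ 2 = Q.eval s t := by
  obtain ⟨x, y, z, hxz, h⟩ := h
  obtain ⟨m, hm, s, t, hst, rfl, rfl⟩ := exists_primitive_padicInt hxz
  have hscaled : (d : ℚ_[l]) * (y / m ^ 2) ^ 2 = (Q.eval s t : ℤ_[l]) := by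
    have hcoe : ((Q.eval s t : ℤ_[l]) : ℚ_[l]) = Q.eval (s : ℚ_[l]) t :=
      map_eval PadicInt.Coe.ringHom s t
    rw [form_eq_eval, eval_mul_mul] at h
    rw [hcoe]
    field_simp
    exact h
  let y' : ℤ_[l] := ⟨y / m ^ 2, norm_le_one_of_squarefree_mul_sq hd (by
    rw [hscaled]
    exact PadicInt.norm_le_one _)⟩
  have hy' : (d : ℤ_[l]) * y' ^ 2 = Q.eval s t := by
    apply PadicInt.ext
    rw [← hscaled]
    push_cast
    rfl
  refine ⟨PadicInt.toZModPow n s, PadicInt.toZModPow n t, PadicInt.toZModPow n y',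
    hst.imp (by rintro rfl; exact map_one _) (by rintro rfl; exact map_one _), ?_⟩
  rw [← map_eval, ← hy']
  simp

/-- Over every field of characteristic zero, the nonzero values of `w * Q` are norms `A² - c B²`
from the quadratic extension generated by `√c`. -/
def IsNormForm (Q : IntQuartic) (w c : ℤ) : Prop :=
  ∀ ⦃K : Type⦄ [Field K] [CharZero K] (x z : K), x ≠ 0 ∨ z ≠ 0 →
    ∃ A B : K, (A ≠ 0 ∨ B ≠ 0) ∧ w * Q.form x z = A ^ 2 - c * B ^ 2

theorem IsNormForm.pos (hQ : Q.IsNormForm w c) (hw : 0 < w) (hc : c < 0)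
    (h : Q.TwistHasPoint d ℝ) : 0 < d := by
  obtain ⟨x, y, z, hxz, h⟩ := h
  obtain ⟨A, B, hAB, hnorm⟩ := hQ x z hxz
  have hw' : (0 : ℝ) < w := by exact_mod_cast hw
  have hc' : (0 : ℝ) < -c := by exact_mod_cast neg_pos.2 hc
  have hpos : 0 < A ^ 2 - c * B ^ 2 := by
    rw [sub_eq_add_neg, ← neg_mul]
    rcases hAB with hA | hB <;> positivity
  rw [← hnorm, ← h] at hpos
  exact_mod_cast pos_of_mul_pos_left (pos_of_mul_pos_right hpos hw'.le) (sq_nonneg y)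

theorem IsNormForm.isSquare_zmod (hQ : Q.IsNormForm w c) (hw : ¬ (l : ℤ) ∣ w) (hd : Squarefree d)
    (hld : (l : ℤ) ∣ d) (h : Q.TwistHasPoint d ℚ_[l]) : IsSquare (c : ZMod l) := by
  by_contra hc
  obtain ⟨x, y, z, hxz, h⟩ := h
  obtain ⟨A, B, hAB, hnorm⟩ := hQ x z hxz
  obtain ⟨hne, heven⟩ := even_valuation_sq_sub_mul_sq hc hAB
  rw [← hnorm, ← h] at hne heven
  obtain ⟨hw0, hd0, hy0⟩ : (w : ℚ_[l]) ≠ 0 ∧ (d : ℚ_[l]) ≠ 0 ∧ y ^ 2 ≠ 0 := by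
    simpa only [mul_ne_zero_iff] using hne
  rw [Padic.valuation_mul hw0 (mul_ne_zero hd0 hy0), Padic.valuation_mul hd0 hy0,
    Padic.valuation_intCast, Padic.valuation_intCast, Padic.valuation_pow,
    padicValInt.eq_zero_of_not_dvd hw, padicValInt_eq_one_of_squarefree hd hld] at heven
  obtain ⟨k, hk⟩ := heven
  push_cast at hk
  omega

theorem twistELS_of_local {p : ℕ} [Fact p.Prime] (hd : d.natAbs = p)
    (hgood : ∀ (l : ℕ) [Fact l.Prime], 5 ≤ l → (d : ZMod l) ≠ 0 → Q.TwistHasPoint d ℚ_[l])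
    (hreal : Q.TwistHasPoint d ℝ) (h2 : Q.TwistHasPoint d ℚ_[2]) (h3 : Q.TwistHasPoint d ℚ_[3])
    (hp : Q.TwistHasPoint d ℚ_[p]) : Q.TwistELS d := by
  refine ⟨hreal, fun l hl => ?_⟩
  rcases eq_or_ne l 2 with rfl | hl2
  · exact h2
  rcases eq_or_ne l 3 with rfl | hl3
  · exact h3
  rcases eq_or_ne l p with rfl | hlp
  · exact hp
  have hl4 : l ≠ 4 := by
    rintro rfl
    exact absurd hl.out (by norm_num)
  have hl5 : 5 ≤ l := by
    have := hl.out.two_le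
    omega
  refine hgood l hl5 ?_
  rwa [Ne, ZMod.intCast_zmod_eq_zero_iff_dvd, Int.natCast_dvd, hd,
    Nat.prime_dvd_prime_iff_eq hl.out Fact.out]

end IntQuartic

section Twists

open IntQuartic

section GoodReduction

open Polynomial

theorem quarticH1_twistHasPoint_of_five_le {d : ℤ} {l : ℕ} [Fact l.Prime] (hl : 5 ≤ l)
    (hd : (d : ZMod l) ≠ 0) : quarticH1.TwistHasPoint d ℚ_[l] := by
  refine twistHasPoint_of_five_le (U := 108 - 112 * X ^ 2) (V := -223 * X + 28 * X ^ 3)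
    (N := 2 ^ 2 * 3 ^ 3 * 13 ^ 2) (k := 3) ?_ (by norm_num) (.inl (by norm_num [quarticH1]))
    (by decide) (by decide) hl hd
  rw [derivative_poly]
  simp only [poly, quarticH1, map_ofNat, map_neg, map_mul, map_pow, map_zero]
  ring

theorem quarticH2_twistHasPoint_of_five_le {d : ℤ} {l : ℕ} [Fact l.Prime] (hl : 5 ≤ l)
    (hd : (d : ZMod l) ≠ 0) : quarticH2.TwistHasPoint d ℚ_[l] := by
  refine twistHasPoint_of_five_le (U := 26288 - 66852 * X + 37008 * X ^ 2)
    (V := -19607 - 835 * X + 19797 * X ^ 2 - 9252 * X ^ 3) (N := 2 ^ 3 * 3 ^ 4 * 13 ^ 2) (k := 4)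
    ?_ (by norm_num) (.inl (by norm_num [quarticH2])) (by decide) (by decide) hl hd
  rw [derivative_poly]
  simp only [poly, quarticH2, map_ofNat, map_neg, map_mul, map_pow]
  ring

theorem quarticF1_twistHasPoint_of_five_le {d : ℤ} {l : ℕ} [Fact l.Prime] (hl : 5 ≤ l)
    (hd : (d : ZMod l) ≠ 0) : quarticF1.TwistHasPoint d ℚ_[l] := by
  refine twistHasPoint_of_five_le (U := 11028 + 16712 * X - 10604 * X ^ 2)
    (V := -12994 + 2260 * X - 3455 * X ^ 2 + 2651 * X ^ 3) (N := 2 ^ 5 * 3 ^ 4 * 13 ^ 2) (k := 5)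
    ?_ (by norm_num) (.inr (by norm_num [quarticF1])) (by decide) (by decide) hl hd
  rw [derivative_poly]
  simp only [poly, quarticF1, map_ofNat, map_mul, map_pow]
  ring

theorem quarticF2_twistHasPoint_of_five_le {d : ℤ} {l : ℕ} [Fact l.Prime] (hl : 5 ≤ l)
    (hd : (d : ZMod l) ≠ 0) : quarticF2.TwistHasPoint d ℚ_[l] := by
  refine twistHasPoint_of_five_le (U := 108 + 28 * X ^ 2) (V := -223 * X - 7 * X ^ 3)
    (N := 2 ^ 4 * 3 ^ 3 * 13 ^ 2) (k := 4) ?_ (by norm_num) (.inl (by norm_num [quarticF2]))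
    (by decide) (by decide) hl hd
  rw [derivative_poly]
  simp only [poly, quarticF2, map_ofNat, map_mul, map_pow, map_zero, map_one]
  ring

end GoodReduction

section NormForms

theorem quarticH1_isNormForm_three : quarticH1.IsNormForm 1 3 := by
  intro K _ _ x z hxz
  refine ⟨2 * x ^ 2 + 13 * z ^ 2, 6 * x * z, ?_, ?_⟩
  · contrapose! hxz
    obtain ⟨hA, hB⟩ := hxz
    rw [← pow_eq_zero_iff (a := x) three_ne_zero, ← pow_eq_zero_iff (a := z) three_ne_zero]
    constructor
    · linear_combination x / 2 * hA - 13 / 12 * z * hB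
    · linear_combination z / 13 * hA - x / 39 * hB
  · simp only [form, quarticH1]
    push_cast
    ring

theorem quarticH2_isNormForm_neg_one : quarticH2.IsNormForm 2 (-1) := by
  intro K _ _ x z hxz
  refine ⟨2 * (3 * x ^ 2 - 2 * x * z - 4 * z ^ 2), 2 * (2 * x * z + z ^ 2), ?_, ?_⟩
  · contrapose! hxz
    obtain ⟨hA, hB⟩ := hxz
    rw [← pow_eq_zero_iff (a := x) three_ne_zero, ← pow_eq_zero_iff (a := z) three_ne_zero]
    constructor
    · linear_combination (x / 6 + z / 9) * hA + 4 * z / 9 * hB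
    · linear_combination -(2 * z / 9) * hA + (x / 3 - 7 * z / 18) * hB
  · simp only [form, quarticH2]
    push_cast
    ring

theorem quarticH2_isNormForm_two : quarticH2.IsNormForm 2 2 := by
  intro K _ _ x z hxz
  refine ⟨2 * (3 * x ^ 2 - 2 * x * z + 5 * z ^ 2), 2 * (5 * x * z - 2 * z ^ 2), ?_, ?_⟩
  · contrapose! hxz
    obtain ⟨hA, hB⟩ := hxz
    rw [← pow_eq_zero_iff (a := x) three_ne_zero, ← pow_eq_zero_iff (a := z) three_ne_zero]
    constructor
    · linear_combination (x / 6 - 7 * z / 117) * hA + (4 * x / 39 - 35 * z / 234) * hB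
    · linear_combination 25 * z / 234 * hA + (2 * z / 117 - 5 * x / 78) * hB
  · simp only [form, quarticH2]
    push_cast
    ring

theorem quarticF1_isNormForm_neg_two : quarticF1.IsNormForm 11 (-2) := by
  intro K _ _ x z hxz
  refine ⟨11 * x ^ 2 + 6 * x * z + 26 * z ^ 2, 2 * x * z - 6 * z ^ 2, ?_, ?_⟩
  · contrapose! hxz
    obtain ⟨hA, hB⟩ := hxz
    rw [← pow_eq_zero_iff (a := x) three_ne_zero, ← pow_eq_zero_iff (a := z) three_ne_zero]
    constructor
    · linear_combination (x / 11 - 12 * z / 143) * hA + (27 * x / 143 - 4 * z / 11) * hB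
    · linear_combination z / 143 * hA - (x / 26 + 3 * z / 22) * hB
  · simp only [form, quarticF1]
    push_cast
    ring

theorem quarticF2_isNormForm_neg_one : quarticF2.IsNormForm 1 (-1) := by
  intro K _ _ x z hxz
  refine ⟨x ^ 2 + 26 * z ^ 2, 2 * x * z, ?_, ?_⟩
  · contrapose! hxz
    obtain ⟨hA, hB⟩ := hxz
    rw [← pow_eq_zero_iff (a := x) three_ne_zero, ← pow_eq_zero_iff (a := z) three_ne_zero]
    constructor
    · linear_combination x * hA - 13 * z * hB
    · linear_combination z / 26 * hA - x / 52 * hB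
  · simp only [form, quarticF2]
    push_cast
    ring

theorem quarticF2_isNormForm_three : quarticF2.IsNormForm 1 3 := by
  intro K _ _ x z hxz
  refine ⟨x ^ 2 + 28 * z ^ 2, 6 * z ^ 2, ?_, ?_⟩
  · contrapose! hxz
    obtain ⟨hA, hB⟩ := hxz
    rw [← pow_eq_zero_iff (a := x) three_ne_zero, ← pow_eq_zero_iff (a := z) three_ne_zero]
    constructor
    · linear_combination x * hA - 14 / 3 * x * hB
    · linear_combination z / 6 * hB
  · simp only [form, quarticF2]
    push_cast
    ring

end NormForms

section Roots

variable {K : Type*} [Field K]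

theorem quarticH1_exists_root [CharZero K] (h : IsSquare (3 : K)) :
    ∃ x : K, quarticH1.form x 1 = 0 := by
  obtain ⟨r, hr⟩ := h
  refine ⟨(1 + 3 * r) / 2, ?_⟩
  simp only [form, quarticH1]
  push_cast
  linear_combination (-9 / 2 * ((9 * r ^ 2 - 27) / 2 + 2 + 6 * r)) * hr

theorem quarticH2_exists_root [CharZero K] (h1 : IsSquare (-1 : K)) (h2 : IsSquare (2 : K)) :
    ∃ x : K, quarticH2.form x 1 = 0 := by
  obtain ⟨i, hi⟩ := h1
  obtain ⟨s, hs⟩ := h2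
  obtain ⟨x, hx⟩ : ∃ x, x = (1 - i + s * (5 - i) / 2) / 3 := ⟨_, rfl⟩
  have hfactor : 3 * x ^ 2 - 2 * x - 4 + i * (2 * x + 1) = 0 := by
    rw [hx]
    linear_combination (-(25 - 10 * i + i ^ 2) / 12) * hs + hi / 6
  refine ⟨x, ?_⟩
  simp only [form, quarticH2]
  push_cast
  linear_combination 2 * (3 * x ^ 2 - 2 * x - 4 - i * (2 * x + 1)) * hfactor
    - 2 * (2 * x + 1) ^ 2 * hi

theorem quarticF1_exists_root (h : IsSquare (-2 : K)) : ∃ x : K, quarticF1.form x 1 = 0 := by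
  obtain ⟨r, hr⟩ := h
  refine ⟨r, ?_⟩
  simp only [form, quarticF1]
  push_cast
  linear_combination -(11 * r ^ 2 + 12 * r + 34) * hr

theorem quarticF2_exists_root (h1 : IsSquare (-1 : K)) (h3 : IsSquare (3 : K)) :
    ∃ x : K, quarticF2.form x 1 = 0 := by
  obtain ⟨i, hi⟩ := h1
  obtain ⟨r, hr⟩ := h3
  have hsq : (i * (1 + 3 * r)) ^ 2 = -28 - 6 * r := by
    linear_combination -(1 + 6 * r + 9 * r ^ 2) * hi + 9 * hr
  refine ⟨i * (1 + 3 * r), ?_⟩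
  simp only [form, quarticF2]
  push_cast
  linear_combination ((i * (1 + 3 * r)) ^ 2 + 28 - 6 * r) * hsq - 36 * hr

end Roots

section TwoAdic

theorem quarticH1_modEq_one_of_twistHasPoint_two {d : ℤ} (hd : Squarefree d)
    (h : quarticH1.TwistHasPoint d ℚ_[2]) : d ≡ 1 [ZMOD 4] := by
  obtain ⟨s, t, y, hst, h⟩ := h.exists_primitive_zmod hd 4
  have hmod : ∀ t y D : ZMod (2 ^ 4), (D * y ^ 2 = quarticH1.eval 1 t ∨
      D * y ^ 2 = quarticH1.eval t 1) → 4 * D = 4 ∨ 4 * D = 0 := by decide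
  have h4 : 4 * (d : ZMod (2 ^ 4)) = 4 ∨ 4 * (d : ZMod (2 ^ 4)) = 0 := by
    rcases hst with rfl | rfl
    exacts [hmod t y d (.inl h), hmod s y d (.inr h)]
  rcases h4 with h4 | h0
  · have h16 : ((4 * d : ℤ) : ZMod (2 ^ 4)) = (4 : ℤ) := by exact_mod_cast h4
    rw [ZMod.intCast_eq_intCast_iff] at h16
    simp only [Int.ModEq] at h16 ⊢
    omega
  · have h16 : ((4 * d : ℤ) : ZMod (2 ^ 4)) = 0 := by exact_mod_cast h0
    rw [ZMod.intCast_zmod_eq_zero_iff_dvd] at h16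
    have h4d : (2 : ℤ) * 2 ∣ d := by omega
    exact absurd (hd 2 h4d) (by decide)

theorem quarticF1_not_twistHasPoint_two : ¬ quarticF1.TwistHasPoint 2 ℚ_[2] := by
  intro h
  obtain ⟨s, t, y, hst, h⟩ := h.exists_primitive_zmod Int.prime_two.squarefree 3
  revert s t y
  decide

theorem quarticF2_not_twistHasPoint_two : ¬ quarticF2.TwistHasPoint 2 ℚ_[2] := by
  intro h
  obtain ⟨s, t, y, hst, h⟩ := h.exists_primitive_zmod Int.prime_two.squarefree 3
  revert s t y
  decide

end TwoAdic

section EverywhereLocallySolvable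

variable {p : ℕ} [Fact p.Prime] {d : ℤ}

theorem squarefree_of_natAbs_eq_prime (hd : d.natAbs = p) : Squarefree d :=
  Int.squarefree_natAbs.1 (hd ▸ (Fact.out : p.Prime).squarefree)

theorem emod_three_eq_one_or_two (hd : d.natAbs = p) (hp3 : p ≠ 3) : d % 3 = 1 ∨ d % 3 = 2 := by
  have := (Nat.prime_dvd_prime_iff_eq Nat.prime_three (Fact.out : p.Prime)).not.2 hp3.symm
  omega

theorem quarticH1_twistELS (hd : d.natAbs = p) (h : d % 12 = 1 ∨ d = -3) :
    quarticH1.TwistELS d := by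
  have hp : p.Prime := Fact.out
  have hd0 : d ≠ 0 := by omega
  have hreal : quarticH1.TwistHasPoint d ℝ := by
    rcases hd0.lt_or_gt with hneg | hpos
    · exact twistHasPoint_real_of_nonneg hd0 3 1 (by decide) (by norm_num [eval, quarticH1]; omega)
    · exact twistHasPoint_real_of_nonneg hd0 0 1 (by decide) (by norm_num [eval, quarticH1]; omega)
  have htwo : quarticH1.TwistHasPoint d ℚ_[2] := by
    rcases (by omega : d % 8 = 1 ∨ d % 8 = 5) with h8 | h8
    · exact twistHasPoint_of_eval_eq_mul_sq hd0 0 1 13 d (by decide) (by simp [eval, quarticH1])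
        (isSquare_padic_two_of_modEq h8)
    · exact twistHasPoint_of_eval_eq_mul_sq hd0 1 1 1 (117 * d) (by decide)
        (by norm_num [eval, quarticH1]; ring)
        (isSquare_padic_two_of_modEq (by unfold Int.ModEq; omega))
  have hthree : quarticH1.TwistHasPoint d ℚ_[3] := by
    rcases h with h | rfl
    · exact twistHasPoint_of_eval_eq_mul_sq hd0 0 1 13 d (by decide) (by simp [eval, quarticH1])
        (isSquare_padic_three_of_modEq (by unfold Int.ModEq; omega))
    · exact twistHasPoint_of_eval_eq_mul_sq hd0 5 1 9 (-47) (by decide) (by decide)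
        (isSquare_padic_three_of_modEq (by decide))
  refine twistELS_of_local hd (fun _ _ => quarticH1_twistHasPoint_of_five_le) hreal htwo hthree ?_
  rcases eq_or_ne p 3 with rfl | hp3
  · exact hthree
  · obtain ⟨x, hx⟩ := quarticH1_exists_root (isSquare_three_padic (p := p) (by omega))
    exact twistHasPoint_of_form_eq_zero x hx

theorem quarticH2_twistELS (hd : d.natAbs = p) (h : (0 < d ∧ d % 8 = 1) ∨ d = 2) :
    quarticH2.TwistELS d := by
  have hd0 : d ≠ 0 := by omega
  have hreal : quarticH2.TwistHasPoint d ℝ :=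
    twistHasPoint_real_of_nonneg hd0 1 1 (by decide) (by norm_num [eval, quarticH2]; omega)
  have htwo : quarticH2.TwistHasPoint d ℚ_[2] := by
    rcases h with ⟨-, h⟩ | rfl
    · exact twistHasPoint_of_eval_eq_mul_sq hd0 1 1 6 d (by decide) (by norm_num [eval, quarticH2])
        (isSquare_padic_two_of_modEq h)
    · exact twistHasPoint_of_eval_eq_mul_sq hd0 1 0 6 1 (by decide) (by decide) (by simp)
  have hthree : quarticH2.TwistHasPoint d ℚ_[3] := by
    have hp3 : p ≠ 3 := by omega
    rcases emod_three_eq_one_or_two hd hp3 with h3 | h3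
    · exact twistHasPoint_of_eval_eq_mul_sq hd0 1 1 6 d (by decide) (by norm_num [eval, quarticH2])
        (isSquare_padic_three_of_modEq h3)
    · exact twistHasPoint_of_eval_eq_mul_sq hd0 1 0 3 (2 * d) (by decide)
        (by norm_num [eval, quarticH2]; ring)
        (isSquare_padic_three_of_modEq (by unfold Int.ModEq; omega))
  refine twistELS_of_local hd (fun _ _ => quarticH2_twistHasPoint_of_five_le) hreal htwo hthree ?_
  rcases eq_or_ne p 2 with rfl | hp2
  · exact htwo
  · obtain ⟨x, hx⟩ := quarticH2_exists_root (isSquare_neg_one_padic (p := p) (by omega))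
      (isSquare_two_padic (by omega))
    exact twistHasPoint_of_form_eq_zero x hx

theorem quarticF1_twistELS (hd : d.natAbs = p) (hpos : 0 < d) (h : d % 8 = 1 ∨ d % 8 = 3) :
    quarticF1.TwistELS d := by
  have hd0 : d ≠ 0 := hpos.ne'
  have h17 : d * quarticF1.eval 0 1 = 17 * d * 2 ^ 2 := by norm_num [eval, quarticF1]; ring
  have h19 : d * quarticF1.eval 1 1 = 19 * d * 3 ^ 2 := by norm_num [eval, quarticF1]; ring
  have hreal : quarticF1.TwistHasPoint d ℝ :=
    twistHasPoint_real_of_nonneg hd0 0 1 (by decide) (by rw [h17]; positivity)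
  have htwo : quarticF1.TwistHasPoint d ℚ_[2] := by
    rcases h with h | h
    · exact twistHasPoint_of_eval_eq_mul_sq hd0 0 1 2 _ (by decide) h17
        (isSquare_padic_two_of_modEq (by unfold Int.ModEq; omega))
    · exact twistHasPoint_of_eval_eq_mul_sq hd0 1 1 3 _ (by decide) h19
        (isSquare_padic_two_of_modEq (by unfold Int.ModEq; omega))
  have hp : quarticF1.TwistHasPoint d ℚ_[p] := by
    obtain ⟨x, hx⟩ := quarticF1_exists_root (isSquare_neg_two_padic (p := p) (by omega))
    exact twistHasPoint_of_form_eq_zero x hx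
  refine twistELS_of_local hd (fun _ _ => quarticF1_twistHasPoint_of_five_le) hreal htwo ?_ hp
  rcases eq_or_ne p 3 with rfl | hp3
  · exact hp
  rcases emod_three_eq_one_or_two hd hp3 with h3 | h3
  · exact twistHasPoint_of_eval_eq_mul_sq hd0 1 1 3 _ (by decide) h19
      (isSquare_padic_three_of_modEq (by unfold Int.ModEq; omega))
  · exact twistHasPoint_of_eval_eq_mul_sq hd0 0 1 2 _ (by decide) h17
      (isSquare_padic_three_of_modEq (by unfold Int.ModEq; omega))

theorem quarticF2_twistELS (hd : d.natAbs = p) (hpos : 0 < d) (h : d % 12 = 1) :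
    quarticF2.TwistELS d := by
  have hd0 : d ≠ 0 := hpos.ne'
  have hinfty : d * quarticF2.eval 1 0 = d * 1 ^ 2 := by simp [eval, quarticF2]
  have hreal : quarticF2.TwistHasPoint d ℝ :=
    twistHasPoint_real_of_nonneg hd0 1 0 (by decide) (by rw [hinfty]; positivity)
  have htwo : quarticF2.TwistHasPoint d ℚ_[2] := by
    rcases (by omega : d % 8 = 1 ∨ d % 8 = 5) with h8 | h8
    · exact twistHasPoint_of_eval_eq_mul_sq hd0 1 0 1 d (by decide) hinfty
        (isSquare_padic_two_of_modEq h8)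
    · exact twistHasPoint_of_eval_eq_mul_sq hd0 1 1 1 (733 * d) (by decide)
        (by norm_num [eval, quarticF2]; ring)
        (isSquare_padic_two_of_modEq (by unfold Int.ModEq; omega))
  have hthree : quarticF2.TwistHasPoint d ℚ_[3] :=
    twistHasPoint_of_eval_eq_mul_sq hd0 1 0 1 d (by decide) hinfty
      (isSquare_padic_three_of_modEq (by unfold Int.ModEq; omega))
  obtain ⟨x, hx⟩ := quarticF2_exists_root (isSquare_neg_one_padic (p := p) (by omega))
    (isSquare_three_padic (by omega))
  exact twistELS_of_local hd (fun _ _ => quarticF2_twistHasPoint_of_five_le) hreal htwo hthree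
    (twistHasPoint_of_form_eq_zero x hx)

theorem IntQuartic.IsNormForm.isSquare_zmod_of_twistELS {Q : IntQuartic} {w c : ℤ}
    (hQ : Q.IsNormForm w c) (hd : d.natAbs = p) (hw : ¬ (p : ℤ) ∣ w) (h : Q.TwistELS d) :
    IsSquare (c : ZMod p) :=
  hQ.isSquare_zmod hw (squarefree_of_natAbs_eq_prime hd) (Int.natCast_dvd.2 hd.symm.dvd) (h.2 p)

theorem quarticH1_twistELS_iff (hd : d.natAbs = p) :
    quarticH1.TwistELS d ↔ d ≡ 1 [ZMOD 12] ∨ d = -3 := by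
  refine ⟨fun h => ?_, quarticH1_twistELS hd⟩
  have h4 : d % 4 = 1 :=
    quarticH1_modEq_one_of_twistHasPoint_two (squarefree_of_natAbs_eq_prime hd) (h.2 2)
  have h3 : IsSquare (3 : ZMod p) := by
    simpa using quarticH1_isNormForm_three.isSquare_zmod_of_twistELS hd
      (by exact_mod_cast (Fact.out : p.Prime).not_dvd_one) h
  rcases eq_or_ne p 3 with rfl | hp3
  · exact Or.inr (by omega)
  · rw [isSquare_three_zmod_iff (by omega) hp3] at h3
    exact Or.inl (by unfold Int.ModEq; omega)

theorem quarticH2_twistELS_iff (hd : d.natAbs = p) :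
    quarticH2.TwistELS d ↔ (0 < d ∧ d ≡ 1 [ZMOD 8]) ∨ d = 2 := by
  refine ⟨fun h => ?_, quarticH2_twistELS hd⟩
  have hpos : 0 < d := quarticH2_isNormForm_neg_one.pos (by decide) (by decide) h.1
  rcases eq_or_ne p 2 with rfl | hp2
  · exact Or.inr (by omega)
  have hw : ¬ (p : ℤ) ∣ 2 := by
    exact_mod_cast (Nat.prime_dvd_prime_iff_eq Fact.out Nat.prime_two).not.2 hp2
  have h1 := quarticH2_isNormForm_neg_one.isSquare_zmod_of_twistELS hd hw h
  have h2 := quarticH2_isNormForm_two.isSquare_zmod_of_twistELS hd hw h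
  push_cast at h1 h2
  rw [ZMod.exists_sq_eq_neg_one_iff] at h1
  rw [ZMod.exists_sq_eq_two_iff hp2] at h2
  exact Or.inl ⟨hpos, by unfold Int.ModEq; omega⟩

theorem quarticF1_twistELS_iff (hd : d.natAbs = p) :
    quarticF1.TwistELS d ↔ 0 < d ∧ (d ≡ 1 [ZMOD 8] ∨ d ≡ 3 [ZMOD 8]) := by
  refine ⟨fun h => ?_, fun h => quarticF1_twistELS hd h.1 h.2⟩
  have hpos : 0 < d := quarticF1_isNormForm_neg_two.pos (by decide) (by decide) h.1
  have hp2 : p ≠ 2 := by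
    rintro rfl
    obtain rfl : d = 2 := by omega
    exact quarticF1_not_twistHasPoint_two (h.2 2)
  refine ⟨hpos, ?_⟩
  simp only [Int.ModEq]
  rcases eq_or_ne p 11 with rfl | hp11
  · omega
  have hw : ¬ (p : ℤ) ∣ 11 := by
    exact_mod_cast (Nat.prime_dvd_prime_iff_eq Fact.out (by norm_num)).not.2 hp11
  have h2 := quarticF1_isNormForm_neg_two.isSquare_zmod_of_twistELS hd hw h
  push_cast at h2
  rw [ZMod.exists_sq_eq_neg_two_iff hp2] at h2
  omega

theorem quarticF2_twistELS_iff (hd : d.natAbs = p) :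
    quarticF2.TwistELS d ↔ 0 < d ∧ d ≡ 1 [ZMOD 12] := by
  refine ⟨fun h => ?_, fun h => quarticF2_twistELS hd h.1 h.2⟩
  have hpos : 0 < d := quarticF2_isNormForm_neg_one.pos (by decide) (by decide) h.1
  have hp2 : p ≠ 2 := by
    rintro rfl
    obtain rfl : d = 2 := by omega
    exact quarticF2_not_twistHasPoint_two (h.2 2)
  have hw : ¬ (p : ℤ) ∣ 1 := by exact_mod_cast (Fact.out : p.Prime).not_dvd_one
  have h1 := quarticF2_isNormForm_neg_one.isSquare_zmod_of_twistELS hd hw h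
  have h3 := quarticF2_isNormForm_three.isSquare_zmod_of_twistELS hd hw h
  push_cast at h1 h3
  rw [ZMod.exists_sq_eq_neg_one_iff] at h1
  have hp3 : p ≠ 3 := by omega
  rw [isSquare_three_zmod_iff hp2 hp3] at h3
  exact ⟨hpos, by unfold Int.ModEq; omega⟩

end EverywhereLocallySolvable

end Twists

theorem proposition2p2 (p : ℕ) (hp : p.Prime) (d : ℤ) (hd : d = (p : ℤ) ∨ d = -(p : ℤ)) :
    (quarticH1.TwistELS d ↔ d ≡ 1 [ZMOD 12] ∨ d = -3) ∧
    (quarticH2.TwistELS d ↔ (0 < d ∧ d ≡ 1 [ZMOD 8]) ∨ d = 2) ∧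
    (quarticF1.TwistELS d ↔ 0 < d ∧ (d ≡ 1 [ZMOD 8] ∨ d ≡ 3 [ZMOD 8])) ∧
    (quarticF2.TwistELS d ↔ 0 < d ∧ d ≡ 1 [ZMOD 12]) := by
  have : Fact p.Prime := ⟨hp⟩
  have hd : d.natAbs = p := Int.natAbs_eq_iff.2 hd
  exact ⟨quarticH1_twistELS_iff hd, quarticH2_twistELS_iff hd, quarticF1_twistELS_iff hd,
    quarticF2_twistELS_iff hd⟩
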